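/- For a commutative $\mathbb{C}$-algebra $A$ with a $\mathbb{C}$-linear derivation $D$, regard $A$ as a vertex algebra with vacuum $1$ and $Y(a,x)b=\sum_{k\ge 0}\frac{1}{k!}(D^k a)\,b\,x^k=\sum_{n\in\mathbb Z}(a_nb)x^{-n-1}$. Let $g$ be a $\mathbb{C}$-algebra automorphism of $A$ of finite order $p$, and for $0\le r<p$ put $A^r=\{u\in A: gu=e^{2\pi i r/p}u\}$. A $g$-twisted vertex algebra $(A,D)$-module is a complex vector space $M$ with a linear map $Y_M(\cdot,x)$, $Y_M(u,x)=\sum_{i\in\frac1p\mathbb Z}u_ix^{-i-1}\in(\operatorname{End}_{\mathbb C}M)[[x^{1/p},x^{-1/p}]]$, such that: $Y_M(u,x)=\sum_{i\in r/p+\mathbb Z}u_ix^{-i-1}$ for $u\in A^r$; $Y_M(u,x)w\in M((x^{1/p}))$ for all $u\in A$, $w\in M$; $Y_M(1,x)=\mathrm{id}_M$; and for $u\in A^r$, $v\in A^s$, $m\in r/p+\mathbb Z$, $n\in s/p+\mathbb Z$, $l\in\mathbb Z$, $$\sum_{i\ge0}\binom mi(u_{l+i}v)_{m+n-i}=\sum_{i\ge0}\binom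 li(-1)^i\bigl(u_{l+m-i}v_{n+i}+(-1)^{l+1}v_{l+n-i}u_{m+i}\bigr).$$ A vertex algebra $(A,D)$-module is the case $g=1$; it is indecomposable if it is non-zero and is not a direct sum of two non-zero subspaces stable under all $u_i$. Let $D$ be a non-zero $\mathbb{C}$-linear derivation of the rational function field $\mathbb{C}(s)$, let $f(s)=\sum_{j=0}^m f_js^j\in\mathbb{C}[s]$ be a square-free polynomial of degree $m\ge 3$, let $K=\mathbb{C}(s)[t]/(t^2-f(s))$, let $\sigma$ be the automorphism of $K$ over $\mathbb{C}(s)$ with $\sigma(t)=-t$, and denote again by $D$ the (unique) extension of $D$ to a derivation of $K$. Let $(M,Y_M)$ be a finite-dimensional indecomposable vertex algebra $(\mathbb{C}(s),D)$-module. Let $S(x)=Y_M(s,x)=\sum_i S_{(i)}x^i$, let $S^{[0]}_{(i)}$ be the semisimple part of $S_{(i)}\in\operatorname{End}_{\mathbb{C}}M$ in its Jordan–Chevalley decomposition, and let $S(x)^{[0]}=\sum_i S^{[0]}_{(i)}x^i$; write $\mathrm{ld}(S(x)^{[0]})$ for the smallest $i$ with $S^{[0]}_{(i)}\ne0$. Let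 $g\in\{1,\sigma\}$ and let $(M,\tilde Y_M)$ be a $g$-twisted vertex algebra $(K,D)$-module whose restriction to $\mathbb{C}(s)$ satisfies $\tilde Y_M(a,x)=Y_M(a,x)$ for all $a\in\mathbb{C}(s)$. Then: 1. if $\mathrm{ld}(S(x)^{[0]})=1$, then $g=\sigma$ if and only if $f_0=0$; 2. if $\mathrm{ld}(S(x)^{[0]})=0$, then $g=\sigma$ if and only if $f(S^{[0]}_{(0)})=0$; 3. if $\mathrm{ld}(S(x)^{[0]})=-1$, then $g=\sigma$ if and only if $\deg f$ is odd. -/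

import Mathlib

open Polynomial

noncomputable section

namespace DiffVertex

section Modules

variable {A : Type*} [CommRing A] [Algebra ℂ A] {M : Type*} [AddCommGroup M] [Module ℂ M]

/-- The `n`-th product `u_n v` of the vertex algebra attached to a commutative algebra `A` with
derivation `D`, i.e. `Y(u, x) v = ∑_{k ≥ 0} (1 / k!) (D^k u) v x^k = ∑_n (u_n v) x^(-n-1)`. -/
def nthProduct (D : Derivation ℂ A A) (u : A) (n : ℤ) (v : A) : A :=
  match n with
  | Int.ofNat _ => 0
  | Int.negSucc k => ((k.factorial : ℂ)⁻¹) • ((D^[k] u) * v)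

/-- `u` lies in `A^r = {u | g u = ζ_p^r u}`, where `p` is the order of `g` and
`ζ_p = exp (2πi / p)`. -/
def InEigenspace (g : A ≃ₐ[ℂ] A) (r : ℕ) (u : A) : Prop :=
  g u = (Complex.exp (2 * Real.pi * Complex.I / (orderOf g : ℂ)) ^ r) • u

/-- `Y` makes `M` a `g`-twisted module over the vertex algebra of `(A, D)`, where `g` has finite
order `p`. The formal series `Y(u, x) = ∑_{i ∈ (1/p)ℤ} u_i x^(-i-1)` with coefficients in `End M` is
encoded by its coefficients: `Y u i` is the mode `u_i`. -/
structure IsTwistedModule (D : Derivation ℂ A A) (g : A ≃ₐ[ℂ] A)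
    (Y : A →ₗ[ℂ] (ℚ → Module.End ℂ M)) : Prop where
  finite_order : IsOfFinOrder g
  /-- only exponents in `(1/p)ℤ` occur -/
  support : ∀ (u : A) (i : ℚ), Y u i ≠ 0 → ∃ k : ℤ, i = (k : ℚ) / (orderOf g : ℚ)
  /-- `Y(u, x) = ∑_{i ∈ r/p + ℤ} u_i x^(-i-1)` for `u ∈ A^r` -/
  support_eigen : ∀ (r : ℕ), r < orderOf g → ∀ u : A, InEigenspace g r u →
    ∀ i : ℚ, Y u i ≠ 0 → ∃ k : ℤ, i = (r : ℚ) / (orderOf g : ℚ) + k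
  /-- `Y(u, x) w ∈ M((x^(1/p)))` -/
  truncation : ∀ (u : A) (w : M), ∃ N : ℚ, ∀ i : ℚ, N ≤ i → Y u i w = 0
  /-- `Y(1, x) = id_M` -/
  vacuum : ∀ i : ℚ, Y 1 i = if i = -1 then 1 else 0
  /-- the twisted Borcherds identity, applied to a vector `w`; by the previous conditions all
  sums have finitely many nonzero terms -/
  borcherds : ∀ (r s : ℕ), r < orderOf g → s < orderOf g →
    ∀ (u v : A), InEigenspace g r u → InEigenspace g s v →
    ∀ (m n : ℚ), (∃ k : ℤ, m = (r : ℚ) / (orderOf g : ℚ) + k) →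
      (∃ k : ℤ, n = (s : ℚ) / (orderOf g : ℚ) + k) →
    ∀ (l : ℤ) (w : M),
      ∑ᶠ i : ℕ, ((Ring.choose m i : ℚ) : ℂ) • Y (nthProduct D u (l + i) v) (m + n - i) w =
      ∑ᶠ i : ℕ, (((Ring.choose l i : ℤ) : ℂ) * (-1) ^ i) •
        (Y u (l + m - i) (Y v (n + i) w) +
          ((-1 : ℂ) ^ (l + 1)) • Y v (l + n - i) (Y u (m + i) w))

/-- A (untwisted) module over the vertex algebra of `(A, D)`. -/
def IsVertexModule (D : Derivation ℂ A A) (Y : A →ₗ[ℂ] (ℚ → Module.End ℂ M)) : Prop :=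
  IsTwistedModule D (1 : A ≃ₐ[ℂ] A) Y

/-- A subspace of `M` stable under all modes. -/
def IsSubmodule (Y : A →ₗ[ℂ] (ℚ → Module.End ℂ M)) (N : Submodule ℂ M) : Prop :=
  ∀ (u : A) (i : ℚ), ∀ w ∈ N, Y u i w ∈ N

/-- `M` is nonzero and is not the direct sum of two nonzero submodules. -/
def IsIndecomposable (Y : A →ₗ[ℂ] (ℚ → Module.End ℂ M)) : Prop :=
  Nontrivial M ∧ ∀ N₁ N₂ : Submodule ℂ M, IsSubmodule Y N₁ → IsSubmodule Y N₂ →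
    IsCompl N₁ N₂ → N₁ = ⊥ ∨ N₂ = ⊥

/-- For `A ⊆ B`, a derivation `DB` of `B` and an automorphism `g` of `B`: `Z` is a `g`-twisted
`(B, DB)`-module structure over the `A`-module `(M, Y)`, i.e. one whose restriction to `A`
is `Y`. -/
def IsTwistedStructureOver {B : Type*} [CommRing B] [Algebra ℂ B] [Algebra A B]
    (DB : Derivation ℂ B B) (g : B ≃ₐ[ℂ] B) (Y : A →ₗ[ℂ] (ℚ → Module.End ℂ M))
    (Z : B →ₗ[ℂ] (ℚ → Module.End ℂ M)) : Prop :=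
  IsTwistedModule DB g Z ∧ ∀ a : A, Z (algebraMap A B a) = Y a

end Modules

section SemisimplePart

variable {M : Type*} [AddCommGroup M] [Module ℂ M] [FiniteDimensional ℂ M]

theorem exists_semisimplePart (X : Module.End ℂ M) :
    ∃ T : Module.End ℂ M, T.IsSemisimple ∧ IsNilpotent (X - T) ∧ Commute X T := by
  obtain ⟨n, _, s, hs, hn, hss, h⟩ := X.exists_isNilpotent_isSemisimple
  refine ⟨s, hss, ?_, ?_⟩
  · rw [h]
    simpa using hn
  · exact Algebra.commute_of_mem_adjoin_self hs

/-- The semisimple part `X^{[0]}` of `X` in its (unique) Jordan–Chevalley decomposition. -/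
def semisimplePart (X : Module.End ℂ M) : Module.End ℂ M :=
  Classical.choose (exists_semisimplePart X)

/-- The coefficient of `x^i` in the coefficientwise semisimple part `H(x)^{[0]}` of a series
`H(x) = ∑_n h_n x^(-n-1)` given by its modes `h`. -/
def semisimpleCoeff (h : ℚ → Module.End ℂ M) (i : ℤ) : Module.End ℂ M :=
  semisimplePart (h (-(i : ℚ) - 1))

/-- `ld(H(x)) = L` for `H(x) = ∑_i (H i) x^i`: the lowest exponent with nonzero coefficient is
`L`. -/
def HasLowestDegree (H : ℤ → Module.End ℂ M) (L : ℤ) : Prop :=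
  IsLeast {i : ℤ | H i ≠ 0} L

end SemisimplePart

section QuadraticExtension

/-- `t^2 - f(s)` as a polynomial in `t` over `ℂ(s)`. -/
def quadPoly (f : ℂ[X]) : (RatFunc ℂ)[X] :=
  X ^ 2 - C (algebraMap ℂ[X] (RatFunc ℂ) f)

/-- `K = ℂ(s)[t] / (t^2 - f(s))`. -/
abbrev QuadExt (f : ℂ[X]) : Type := AdjoinRoot (quadPoly f)

theorem eval₂_quadPoly {B : Type*} [CommRing B] (f : ℂ[X]) (i : RatFunc ℂ →+* B) (y : B) :
    (quadPoly f).eval₂ i y = y ^ 2 - i (algebraMap ℂ[X] (RatFunc ℂ) f) := by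
  rw [quadPoly, eval₂_sub, eval₂_pow, eval₂_X, eval₂_C]

theorem eval₂_neg_root (f : ℂ[X]) :
    (quadPoly f).eval₂ (Algebra.ofId (RatFunc ℂ) (QuadExt f))
      (-AdjoinRoot.root (quadPoly f)) = 0 := by
  have h := AdjoinRoot.eval₂_root (quadPoly f)
  rw [eval₂_quadPoly] at h ⊢
  rw [neg_sq]
  exact h

/-- The `ℂ(s)`-algebra endomorphism `t ↦ -t` of `K`. -/
def sigmaHom (f : ℂ[X]) : QuadExt f →ₐ[RatFunc ℂ] QuadExt f :=
  AdjoinRoot.liftAlgHom (quadPoly f) (Algebra.ofId (RatFunc ℂ) (QuadExt f))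
    (-AdjoinRoot.root (quadPoly f)) (eval₂_neg_root f)

theorem sigmaHom_comp (f : ℂ[X]) :
    (sigmaHom f).comp (sigmaHom f) = AlgHom.id (RatFunc ℂ) (QuadExt f) := by
  apply AdjoinRoot.algHom_ext
  simp [sigmaHom]

/-- The automorphism `σ` of `K` over `ℂ(s)` mapping `t` to `-t`, as a `ℂ`-algebra automorphism. -/
def sigma (f : ℂ[X]) : QuadExt f ≃ₐ[ℂ] QuadExt f :=
  (AlgEquiv.ofAlgHom (sigmaHom f) (sigmaHom f) (sigmaHom_comp f) (sigmaHom_comp f)).restrictScalars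
    ℂ

end QuadraticExtension

end DiffVertex

end

open Polynomial

noncomputable section

/-! The modes of `Y` and the modes of t under `Z` all commute, so they have a common eigenvector w.
Its eigenvalues attach to each element of ℂ(s) a Laurent series in x, on which D acts as d/dx
(`IsVertexModule.exists_isLaurentPlace`); the lowest degree behaves like a valuation. The modes of t
are indexed by ℤ when g = 1 and by 1/2 + ℤ when g = σ. As t² = f(s), the order of f(s) is even in
the first case and odd in the second (`IsTwistedStructureOver.exists_order`).

It remains to read off this order. By indecomposability the semisimple part of each mode of s is its
eigenvalue on w times the identity (`IsIndecomposable.isNilpotent_sub`), so ld is the order of s. If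
s has no pole and constant term λ, then s - λ is a uniformizer (`hasOrder_X_sub_C`), and the
square-free f has order 1 or 0 according to whether f(λ) vanishes. If s has a simple pole, f(s) has
order -deg f. -/

namespace DiffVertex

/-! ### Common eigenvectors and semisimple parts -/

section LinearAlgebra

variable {M : Type*} [AddCommGroup M] [Module ℂ M] [FiniteDimensional ℂ M]

/-- Pairwise commuting endomorphisms have a common eigenvector in every nonzero stable subspace. -/
theorem exists_common_eigenvector_mem (S : Set (Module.End ℂ M))
    (hS : ∀ T₁ ∈ S, ∀ T₂ ∈ S, Commute T₁ T₂) (N : Submodule ℂ M) (hN : N ≠ ⊥)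
    (hstable : ∀ T ∈ S, ∀ w ∈ N, T w ∈ N) :
    ∃ w ∈ N, w ≠ 0 ∧ ∀ T ∈ S, ∃ c : ℂ, T w = c • w := by
  induction hn : Module.finrank ℂ N using Nat.strong_induction_on generalizing N with
  | _ n ih =>
  by_cases hscalar : ∀ T ∈ S, ∃ c : ℂ, ∀ w ∈ N, T w = c • w
  · obtain ⟨w, hw, hw0⟩ := N.exists_mem_ne_zero_of_ne_bot hN
    exact ⟨w, hw, hw0, fun T hT => (hscalar T hT).imp fun c hc => hc w hw⟩
  · push Not at hscalar
    obtain ⟨T, hT, hne⟩ := hscalar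
    have : Nontrivial N := (Submodule.nontrivial_iff_ne_bot).2 hN
    obtain ⟨μ, hμ⟩ := Module.End.exists_eigenvalue (T.restrict (hstable T hT))
    obtain ⟨v, hv, hv0⟩ := hμ.exists_hasEigenvector
    have hTv : T v = μ • (v : M) := by
      simpa using congrArg Subtype.val (Module.End.mem_eigenspace_iff.1 hv)
    -- Strictly smaller than N because T is not scalar on N, and stable because the family commutes.
    let N' : Submodule ℂ M := N ⊓ Module.End.eigenspace T μ
    have hvN' : (v : M) ∈ N' := ⟨v.2, Module.End.mem_eigenspace_iff.2 hTv⟩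
    have hN' : N' ≠ ⊥ := fun h => hv0 (by
      rw [h, Submodule.mem_bot] at hvN'
      exact Subtype.ext hvN')
    have hlt : N' < N := by
      refine lt_of_le_of_ne inf_le_left fun h => ?_
      obtain ⟨w, hw, hTw⟩ := hne μ
      rw [← h] at hw
      exact hTw (Module.End.mem_eigenspace_iff.1 hw.2)
    obtain ⟨w, hw, hw0, hwS⟩ := ih _ (hn ▸ Submodule.finrank_lt_finrank_of_lt hlt) N' hN'
      (fun T' hT' w hw => ⟨hstable T' hT' w hw.1, by
        rw [SetLike.mem_coe, Module.End.mem_eigenspace_iff, ← Module.End.mul_apply, 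
          (hS T hT T' hT').eq,
          Module.End.mul_apply, Module.End.mem_eigenspace_iff.1 hw.2, map_smul]⟩) rfl
    exact ⟨w, hw.1, hw0, hwS⟩

theorem exists_common_eigenvector [Nontrivial M] (S : Set (Module.End ℂ M))
    (hS : ∀ T₁ ∈ S, ∀ T₂ ∈ S, Commute T₁ T₂) :
    ∃ w : M, w ≠ 0 ∧ ∀ T ∈ S, ∃ c : ℂ, T w = c • w := by
  obtain ⟨w, -, hw⟩ := exists_common_eigenvector_mem S hS ⊤ (by simp) (by simp)
  exact ⟨w, hw⟩

/-- An endomorphism with a single eigenvalue has scalar semisimple part. -/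
theorem semisimplePart_eq_smul_one {T : Module.End ℂ M} {μ : ℂ}
    (h : IsNilpotent (T - algebraMap ℂ (Module.End ℂ M) μ)) :
    semisimplePart T = μ • (1 : Module.End ℂ M) := by
  obtain ⟨hss, hnil, hcomm⟩ := Classical.choose_spec (exists_semisimplePart T)
  change (semisimplePart T).IsSemisimple at hss
  change IsNilpotent (T - semisimplePart T) at hnil
  change Commute T (semisimplePart T) at hcomm
  have hμ := Algebra.commutes (R := ℂ) (A := Module.End ℂ M) μ
  have hc : Commute (T - algebraMap ℂ (Module.End ℂ M) μ) (T - semisimplePart T) :=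
    ((Commute.refl T).sub_right hcomm).sub_left (hμ _)
  -- The difference of these commuting nilpotents is the semisimple part minus μ, which is both
  -- nilpotent and semisimple, hence zero.
  have hnil' := hc.isNilpotent_sub h hnil
  rw [sub_sub_sub_cancel_left] at hnil'
  have hss' := Module.End.isSemisimple_sub_algebraMap_iff (μ := μ) |>.2 hss
  have := Module.End.eq_zero_of_isNilpotent_isSemisimple hnil' hss'
  rw [sub_eq_zero.1 this, Algebra.algebraMap_eq_smul_one]

variable {A : Type*} [CommRing A] [Algebra ℂ A]

/-- On an indecomposable module an endomorphism commuting with all modes has at most one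
eigenvalue. -/
theorem IsIndecomposable.isNilpotent_sub {Y : A →ₗ[ℂ] (ℚ → Module.End ℂ M)}
    (hY : IsIndecomposable Y) {T : Module.End ℂ M} (hT : ∀ u i, Commute T (Y u i))
    {μ : ℂ} {w : M} (hw0 : w ≠ 0) (hw : T w = μ • w) :
    IsNilpotent (T - algebraMap ℂ (Module.End ℂ M) μ) := by
  set N := T - algebraMap ℂ (Module.End ℂ M) μ with hN
  have hNY : ∀ u i, Commute N (Y u i) := fun u i =>
    (hT u i).sub_left (Algebra.commutes (R := ℂ) (A := Module.End ℂ M) μ _)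
  -- Fitting decomposition: kernel and range of a high power of N are complementary submodules, and
  -- the kernel contains w. The exponent n + 1 is used so that it is positive.
  obtain ⟨n, hn⟩ := Filter.eventually_atTop.1 (LinearMap.eventually_isCompl_ker_pow_range_pow N)
  have hcompl := hn (n + 1) n.le_succ
  have hpow : ∀ u i, Commute (N ^ (n + 1)) (Y u i) := fun u i => (hNY u i).pow_left _
  have hNw : N w = 0 := by simp [hN, hw, Module.algebraMap_end_apply]
  have hker : LinearMap.ker (N ^ (n + 1)) ≠ ⊥ := fun h => hw0 (by
    have : w ∈ LinearMap.ker (N ^ (n + 1)) := by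
      rw [LinearMap.mem_ker, pow_succ, Module.End.mul_apply, hNw, map_zero]
    rwa [h, Submodule.mem_bot] at this)
  have hrange := (hY.2 _ _ (fun u i v hv => by
      rw [LinearMap.mem_ker] at hv ⊢
      rw [← Module.End.mul_apply, (hpow u i).eq, Module.End.mul_apply, hv, map_zero])
    (fun u i v hv => by
      obtain ⟨v', rfl⟩ := hv
      exact ⟨Y u i v', by
        rw [← Module.End.mul_apply, (hpow u i).eq, Module.End.mul_apply]⟩) hcompl).resolve_left hker
  exact ⟨n + 1, LinearMap.range_eq_bot.1 hrange⟩

end LinearAlgebra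

/-! ### Consequences of the twisted Borcherds identity -/

section Modes

variable {A : Type*} [CommRing A] [Algebra ℂ A] {M : Type*} [AddCommGroup M] [Module ℂ M]
  {D : Derivation ℂ A A} {g : A ≃ₐ[ℂ] A} {Y : A →ₗ[ℂ] (ℚ → Module.End ℂ M)}

theorem nthProduct_of_nonneg (u v : A) {n : ℤ} (hn : 0 ≤ n) : nthProduct D u n v = 0 := by
  obtain ⟨k, rfl⟩ := Int.eq_ofNat_of_zero_le hn
  rfl

theorem nthProduct_neg_one (u v : A) : nthProduct D u (-1) v = u * v := by
  change ((Nat.factorial 0 : ℂ)⁻¹) • ((D^[0] u) * v) = u * v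
  simp

theorem nthProduct_neg_two (u v : A) : nthProduct D u (-2) v = D u * v := by
  change ((Nat.factorial 1 : ℂ)⁻¹) • ((D^[1] u) * v) = D u * v
  simp

theorem inEigenspace_one (u : A) : InEigenspace (1 : A ≃ₐ[ℂ] A) 0 u := by
  simp [InEigenspace]

/-- At l = 0 the Borcherds identity has zero left side, since nonnegative products vanish, and its
right side is the commutator. Modes outside the prescribed cosets are zero. -/
theorem IsTwistedModule.commute (hY : IsTwistedModule D g Y) {r s : ℕ} (hr : r < orderOf g)
    (hs : s < orderOf g) {u v : A} (hu : InEigenspace g r u) (hv : InEigenspace g s v) (i j : ℚ) :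
    Commute (Y u i) (Y v j) := by
  by_cases hi : Y u i = 0
  · rw [hi]; exact Commute.zero_left _
  by_cases hj : Y v j = 0
  · rw [hj]; exact Commute.zero_right _
  refine LinearMap.ext fun w => ?_
  have h := hY.borcherds r s hr hs u v hu hv i j (hY.support_eigen r hr u hu i hi)
    (hY.support_eigen s hs v hv j hj) 0 w
  rw [finsum_eq_zero_of_forall_eq_zero (fun k => by
      rw [nthProduct_of_nonneg _ _ (by positivity)]; simp),
    finsum_eq_single _ 0 (fun k hk => by
      rw [Ring.choose_zero_pos ℤ (Nat.pos_of_ne_zero hk)]; simp)] at h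
  simp only [Ring.choose_zero_right] at h
  simp at h
  rw [← sub_eq_add_neg, eq_comm, sub_eq_zero] at h
  exact h

/-- If `u_i w = 0` for `i > p` and `v_j w = 0` for `j > q`, then the top mode of `u v` on `w` is
`u_p v_q`. -/
theorem IsTwistedModule.mul_top (hY : IsTwistedModule D g Y) {r s : ℕ} (hr : r < orderOf g)
    (hs : s < orderOf g) {u v : A} (hu : InEigenspace g r u) (hv : InEigenspace g s v) {p q : ℚ}
    (hp : ∃ k : ℤ, p = (r : ℚ) / (orderOf g : ℚ) + k)
    (hq : ∃ k : ℤ, q = (s : ℚ) / (orderOf g : ℚ) + k) {w : M}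
    (hup : ∀ i : ℕ, Y u (p + 1 + i) w = 0) (hvq : ∀ i : ℕ, Y v (q + 1 + i) w = 0) :
    Y (u * v) (p + q + 1) w = Y u p (Y v q w) := by
  obtain ⟨k, hk⟩ := hp
  -- With l = -1, m = p + 1 and n = q, only the i = 0 term survives on each side, and the reversed
  -- product is killed by u_{p+1} w = 0.
  have h := hY.borcherds r s hr hs u v hu hv (p + 1) q
    ⟨k + 1, by rw [hk]; push_cast; ring⟩ hq (-1) w
  rw [finsum_eq_single _ 0 (fun i hi => by
      rw [nthProduct_of_nonneg _ _ (by omega)]; simp),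
    finsum_eq_single _ 0 (fun i hi => by
      obtain ⟨i, rfl⟩ := Nat.exists_eq_succ_of_ne_zero hi
      rw [hup, show q + ((i.succ : ℕ) : ℚ) = q + 1 + i by push_cast; ring, hvq]; simp)] at h
  have hup0 := hup 0
  simp only [Ring.choose_zero_right, Nat.cast_zero, add_zero, nthProduct_neg_one, sub_zero] at h hup0
  rw [hup0] at h
  simpa [show p + 1 + q = p + q + 1 by ring] using h

/-- If `u_i w = 0` for `i > p` and `v_j w = 0` for `j > q`, then `(u v)_k w = 0` for
`k > p + q + 1`. -/
theorem IsTwistedModule.mul_above_top (hY : IsTwistedModule D g Y) {r s : ℕ} (hr : r < orderOf g)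
    (hs : s < orderOf g) {u v : A} (hu : InEigenspace g r u) (hv : InEigenspace g s v) {p q : ℚ}
    (hp : ∃ k : ℤ, p = (r : ℚ) / (orderOf g : ℚ) + k)
    (hq : ∃ k : ℤ, q = (s : ℚ) / (orderOf g : ℚ) + k) {w : M}
    (hup : ∀ i : ℕ, Y u (p + 1 + i) w = 0) (hvq : ∀ i : ℕ, Y v (q + 1 + i) w = 0) (d : ℕ) :
    Y (u * v) (p + q + 1 + (d + 1)) w = 0 := by
  obtain ⟨k, hk⟩ := hp
  have h := hY.mul_top hr hs hu hv (p := p + 1 + d) (w := w)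
    ⟨k + 1 + d, by rw [hk]; push_cast; ring⟩ hq
    (fun i => by
      have := hup (d + 1 + i)
      rwa [show p + 1 + ((d + 1 + i : ℕ) : ℚ) = p + 1 + d + 1 + i by push_cast; ring] at this) hvq
  rw [show p + q + 1 + ((d : ℚ) + 1) = p + 1 + d + q + 1 by ring, h, ← Module.End.mul_apply,
    (hY.commute hr hs hu hv _ _).eq, Module.End.mul_apply, hup, map_zero]

theorem IsVertexModule.commute (hY : IsVertexModule D Y) (u v : A) (i j : ℚ) :
    Commute (Y u i) (Y v j) :=
  IsTwistedModule.commute hY (r := 0) (s := 0) (by simp) (by simp) (inEigenspace_one u)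
    (inEigenspace_one v) i j

/-- `Y(D u, x) = (d / dx) Y(u, x)`. -/
theorem IsVertexModule.derivation (hY : IsVertexModule D Y) (u : A) (m : ℤ) :
    Y (D u) m = -(m : ℂ) • Y u (m - 1) := by
  refine LinearMap.ext fun w => ?_
  -- With v = 1, l = -2 and n = 0, the modes of 1 on the right have index i or -2 - i, never -1. The
  -- left side is (D u)_m + m u_{m-1}.
  have h := hY.borcherds 0 0 (by simp) (by simp) u 1 (inEigenspace_one u) (inEigenspace_one 1)
    m 0 ⟨m, by simp⟩ ⟨0, by simp⟩ (-2) w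
  rw [finsum_eq_sum_of_support_subset (s := Finset.range 2) _ (fun i hi => by
      by_contra hi'
      refine hi ?_
      simp only [Finset.coe_range, Set.mem_Iio, not_lt] at hi'
      simp only
      rw [nthProduct_of_nonneg _ _ (by omega)]; simp),
    finsum_eq_zero_of_forall_eq_zero (fun i => by
      have hi : (0 : ℚ) ≤ i := by positivity
      rw [hY.vacuum, hY.vacuum, if_neg (by linarith), if_neg (by push_cast; linarith)]
      simp), Finset.sum_range_succ, Finset.sum_range_one] at h
  simp only [Ring.choose_zero_right, Ring.choose_one_right] at h
  norm_num [nthProduct_neg_one, nthProduct_neg_two] at h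
  simpa using eq_neg_of_add_eq_zero_left h

end Modes

/-! ### Orders of rational functions at a place -/

section Places

/-- The coefficients `c u j` of a family of Laurent series `∑_j (c u j) x^j`, linear in `u` and
multiplicative on leading terms. -/
structure IsLaurentPlace (c : RatFunc ℂ →ₗ[ℂ] (ℤ → ℂ)) : Prop where
  one : ∀ j, c 1 j = if j = 0 then 1 else 0
  bounded : ∀ u, ∃ N, ∀ j < N, c u j = 0
  mul : ∀ u v a b, (∀ j < a, c u j = 0) → (∀ j < b, c v j = 0) → c (u * v) (a + b) = c u a * c v b

/-- The series of `u` has lowest degree `a`. -/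
def HasOrder (c : RatFunc ℂ →ₗ[ℂ] (ℤ → ℂ)) (u : RatFunc ℂ) (a : ℤ) : Prop :=
  (∀ j < a, c u j = 0) ∧ c u a ≠ 0

variable {c : RatFunc ℂ →ₗ[ℂ] (ℤ → ℂ)} {u v : RatFunc ℂ} {a b : ℤ}

theorem HasOrder.unique (hu : HasOrder c u a) (hv : HasOrder c u b) : a = b := by
  rcases lt_trichotomy a b with h | h | h
  · exact absurd (hv.1 a h) hu.2
  · exact h
  · exact absurd (hu.1 b h) hv.2

namespace IsLaurentPlace

theorem mul_below (hc : IsLaurentPlace c) (hu : ∀ j < a, c u j = 0) (hv : ∀ j < b, c v j = 0) :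
    ∀ j < a + b, c (u * v) j = 0 := fun j hj => by
  have h := hc.mul u v (j - b) b (fun i hi => hu i (by omega)) hv
  rw [hu (j - b) (by omega), zero_mul, sub_add_cancel] at h
  exact h

theorem hasOrder_mul (hc : IsLaurentPlace c) (hu : HasOrder c u a) (hv : HasOrder c v b) :
    HasOrder c (u * v) (a + b) :=
  ⟨hc.mul_below hu.1 hv.1, by rw [hc.mul u v a b hu.1 hv.1]; exact mul_ne_zero hu.2 hv.2⟩

theorem hasOrder_one (hc : IsLaurentPlace c) : HasOrder c 1 0 :=
  ⟨fun j hj => by rw [hc.one, if_neg hj.ne], by simp [hc.one]⟩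

theorem hasOrder_pow (hc : IsLaurentPlace c) (hu : HasOrder c u a) (n : ℕ) :
    HasOrder c (u ^ n) (n * a) := by
  induction n with
  | zero => simpa using hc.hasOrder_one
  | succ n ih =>
    rw [pow_succ, Nat.cast_succ, add_one_mul]
    exact hc.hasOrder_mul ih hu

/-- If the series of u vanished, multiplying by u⁻¹ would make the constant term of 1 zero. -/
theorem exists_hasOrder (hc : IsLaurentPlace c) (hu : u ≠ 0) : ∃ a, HasOrder c u a := by
  have hne : ∃ j, c u j ≠ 0 := by
    by_contra! h
    obtain ⟨N, hN⟩ := hc.bounded u⁻¹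
    have h1 := hc.mul u u⁻¹ (-N) N (fun j _ => h j) hN
    rw [mul_inv_cancel₀ hu, h, hc.one] at h1
    simp at h1
  obtain ⟨N, hN⟩ := hc.bounded u
  obtain ⟨a, ha, hmin⟩ := Int.exists_least_of_bdd (P := fun j => c u j ≠ 0)
    ⟨N, fun j hj => by by_contra h; exact hj (hN j (not_le.1 h))⟩ hne
  exact ⟨a, fun j hj => by by_contra h; exact absurd (hmin j h) (not_le.2 hj), ha⟩

theorem apply_C (hc : IsLaurentPlace c) (z : ℂ) (j : ℤ) :
    c (RatFunc.C z) j = if j = 0 then z else 0 := by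
  rw [show RatFunc.C z = z • (1 : RatFunc ℂ) by rw [RatFunc.smul_eq_C_mul, mul_one], map_smul,
    Pi.smul_apply, hc.one]
  simp

/-- At a point where `s` has no pole, a polynomial `p(s)` has constant term `p(λ)`. -/
theorem eval_below (hc : IsLaurentPlace c) (hs : ∀ j < 0, c RatFunc.X j = 0) (p : ℂ[X]) :
    (∀ j < 0, c (algebraMap ℂ[X] (RatFunc ℂ) p) j = 0) ∧
      c (algebraMap ℂ[X] (RatFunc ℂ) p) 0 = p.eval (c RatFunc.X 0) := by
  induction p using Polynomial.induction_on with
  | C z =>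
    rw [RatFunc.algebraMap_C]
    exact ⟨fun j hj => by rw [hc.apply_C, if_neg hj.ne], by simp [hc.apply_C]⟩
  | add p q hp hq =>
    refine ⟨fun j hj => ?_, ?_⟩
    · rw [map_add, map_add, Pi.add_apply, hp.1 j hj, hq.1 j hj, add_zero]
    · rw [map_add, map_add, Pi.add_apply, hp.2, hq.2, eval_add]
  | monomial n z ih =>
    rw [pow_succ, ← mul_assoc, map_mul, RatFunc.algebraMap_X]
    refine ⟨fun j hj => hc.mul_below ih.1 hs j (by simpa using hj), ?_⟩
    have h := hc.mul _ _ 0 0 ih.1 hs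
    rw [add_zero, ih.2] at h
    rw [h, eval_mul_X]

theorem hasOrder_zero_of_eval_ne_zero (hc : IsLaurentPlace c) (hs : ∀ j < 0, c RatFunc.X j = 0)
    {p : ℂ[X]} (hp : p.eval (c RatFunc.X 0) ≠ 0) :
    HasOrder c (algebraMap ℂ[X] (RatFunc ℂ) p) 0 :=
  ⟨(hc.eval_below hs p).1, by rwa [(hc.eval_below hs p).2]⟩

/-- At a point where `s` has no pole, the order of `p(s)` is a multiple of that of `s - λ`. -/
theorem exists_hasOrder_polynomial (hc : IsLaurentPlace c) (hs : ∀ j < 0, c RatFunc.X j = 0)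
    {k : ℤ} (hk : HasOrder c (algebraMap ℂ[X] (RatFunc ℂ) (X - C (c RatFunc.X 0))) k)
    {p : ℂ[X]} (hp : p ≠ 0) : ∃ e : ℕ, HasOrder c (algebraMap ℂ[X] (RatFunc ℂ) p) (e * k) := by
  obtain ⟨q, hpq, hq⟩ := p.exists_eq_pow_rootMultiplicity_mul_and_not_dvd hp (c RatFunc.X 0)
  have hq0 := hc.hasOrder_zero_of_eval_ne_zero hs (p := q) (fun h => hq (dvd_iff_isRoot.2 h))
  refine ⟨p.rootMultiplicity (c RatFunc.X 0), ?_⟩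
  have h := hc.hasOrder_mul (hc.hasOrder_pow hk (p.rootMultiplicity (c RatFunc.X 0))) hq0
  rwa [add_zero, ← map_pow, ← map_mul, ← hpq] at h

/-- At a point where `s` has no pole, `s - λ` is a uniformizer. -/
theorem hasOrder_X_sub_C (hc : IsLaurentPlace c) (hs : ∀ j < 0, c RatFunc.X j = 0)
    {D : Derivation ℂ (RatFunc ℂ) (RatFunc ℂ)}
    (hD : ∀ u j, c (D u) j = ((j : ℂ) + 1) * c u (j + 1)) :
    HasOrder c (algebraMap ℂ[X] (RatFunc ℂ) (X - C (c RatFunc.X 0))) 1 := by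
  obtain ⟨k, hk⟩ := hc.exists_hasOrder (u := algebraMap ℂ[X] (RatFunc ℂ) (X - C (c RatFunc.X 0)))
    (by rw [Ne, FaithfulSMul.algebraMap_eq_zero_iff]; exact X_sub_C_ne_zero _)
  have hpos : 0 < k := by
    obtain ⟨hneg, hzero⟩ := hc.eval_below hs (X - C (c RatFunc.X 0))
    rw [eval_sub, eval_X, eval_C, sub_self] at hzero
    by_contra! h
    rcases h.lt_or_eq with h | rfl
    · exact hk.2 (hneg k h)
    · exact hk.2 hzero
  generalize hy : algebraMap ℂ[X] (RatFunc ℂ) (X - C (c RatFunc.X 0)) = y at hk ⊢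
  -- Differentiation lowers the nonzero order k by one, while every nonzero rational function has
  -- order a multiple of k. Hence k divides 1.
  have hDy : HasOrder c (D y) (k - 1) := by
    refine ⟨fun j hj => by rw [hD, hk.1 _ (by omega), mul_zero], ?_⟩
    rw [hD, sub_add_cancel]
    refine mul_ne_zero ?_ hk.2
    push_cast
    rw [sub_add_cancel]
    exact_mod_cast hpos.ne'
  have hDy0 : D y ≠ 0 := fun h => hDy.2 (by rw [h]; simp)
  rw [← hy] at hk
  obtain ⟨e₁, h₁⟩ := hc.exists_hasOrder_polynomial hs hk (RatFunc.num_ne_zero hDy0)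
  obtain ⟨e₂, h₂⟩ := hc.exists_hasOrder_polynomial hs hk (RatFunc.denom_ne_zero (D y))
  have h := hc.hasOrder_mul hDy h₂
  have hnd : D y * algebraMap ℂ[X] (RatFunc ℂ) (D y).denom =
      algebraMap ℂ[X] (RatFunc ℂ) (D y).num := by
    refine (eq_div_iff ?_).1 (RatFunc.num_div_denom (D y)).symm
    rw [Ne, FaithfulSMul.algebraMap_eq_zero_iff]
    exact RatFunc.denom_ne_zero _
  rw [hnd] at h
  have heq := h.unique h₁
  have hdvd : k ∣ 1 := ⟨1 + e₂ - e₁, by linear_combination -heq⟩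
  have hk1 : k = 1 := Int.eq_one_of_dvd_one hpos.le hdvd
  rwa [hk1, hy] at hk

/-- Square-freeness makes every root of f simple, so the order is 1 at a root and 0 elsewhere. -/
theorem odd_order_iff_eval_eq_zero (hc : IsLaurentPlace c) (hs : ∀ j < 0, c RatFunc.X j = 0)
    {D : Derivation ℂ (RatFunc ℂ) (RatFunc ℂ)}
    (hD : ∀ u j, c (D u) j = ((j : ℂ) + 1) * c u (j + 1)) {f : ℂ[X]} (hf : Squarefree f) {n : ℤ}
    (hn : HasOrder c (algebraMap ℂ[X] (RatFunc ℂ) f) n) :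
    Odd n ↔ f.eval (c RatFunc.X 0) = 0 := by
  constructor
  · intro hodd
    by_contra h
    rw [hn.unique (hc.hasOrder_zero_of_eval_ne_zero hs h)] at hodd
    exact absurd hodd (by decide)
  · intro h
    obtain ⟨q, hq⟩ := dvd_iff_isRoot.2 h
    have hq0 : q.eval (c RatFunc.X 0) ≠ 0 := fun h0 => by
      obtain ⟨q', rfl⟩ := dvd_iff_isRoot.2 h0
      exact not_isUnit_X_sub_C _ (hf _ ⟨q', by rw [hq, mul_assoc]⟩)
    have h1 := hc.hasOrder_mul (hc.hasOrder_X_sub_C hs hD) (hc.hasOrder_zero_of_eval_ne_zero hs hq0)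
    rw [← map_mul, ← hq] at h1
    rw [hn.unique h1]
    decide

/-- If `s` has a simple pole, the order of `p(s)` is minus the degree of `p`. -/
theorem hasOrder_neg_natDegree (hc : IsLaurentPlace c) (hs : HasOrder c RatFunc.X (-1))
    {p : ℂ[X]} (hp : p ≠ 0) :
    HasOrder c (algebraMap ℂ[X] (RatFunc ℂ) p) (-(p.natDegree : ℤ)) := by
  have hpow : ∀ n : ℕ, HasOrder c (RatFunc.X ^ n) (-(n : ℤ)) := fun n => by
    simpa using hc.hasOrder_pow hs n
  have hsum : ∀ j, c (algebraMap ℂ[X] (RatFunc ℂ) p) j =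
      ∑ i ∈ Finset.range (p.natDegree + 1), p.coeff i * c (RatFunc.X ^ i) j := fun j => by
    conv_lhs => rw [p.as_sum_range_C_mul_X_pow]
    simp only [map_sum, map_mul, map_pow, RatFunc.algebraMap_C, RatFunc.algebraMap_X,
      ← RatFunc.smul_eq_C_mul, map_smul, Finset.sum_apply, Pi.smul_apply, smul_eq_mul]
  constructor
  · intro j hj
    rw [hsum]
    refine Finset.sum_eq_zero fun i hi => ?_
    rw [(hpow i).1 j (by rw [Finset.mem_range] at hi; omega), mul_zero]
  -- Only the leading monomial reaches degree -deg p, so nothing cancels it.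
  · rw [hsum, Finset.sum_range_succ, Finset.sum_eq_zero fun i hi => by
      rw [(hpow i).1 _ (by rw [Finset.mem_range] at hi; omega), mul_zero], zero_add]
    exact mul_ne_zero (by simpa using hp) (hpow _).2

end IsLaurentPlace

end Places

/-! ### From a common eigenvector to a place -/

section EigenvectorPlace

variable {M : Type*} [AddCommGroup M] [Module ℂ M] {D : Derivation ℂ (RatFunc ℂ) (RatFunc ℂ)}
  {Y : RatFunc ℂ →ₗ[ℂ] (ℚ → Module.End ℂ M)}

/-- The eigenvalues of the modes on a common eigenvector form a family of Laurent series. -/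
theorem IsVertexModule.exists_isLaurentPlace (hY : IsVertexModule D Y) {w : M} (hw0 : w ≠ 0)
    (hw : ∀ u i, ∃ z : ℂ, Y u i w = z • w) :
    ∃ c : RatFunc ℂ →ₗ[ℂ] (ℤ → ℂ), (∀ u (j : ℤ), Y u (-(j : ℚ) - 1) w = c u j • w) ∧
      IsLaurentPlace c ∧ ∀ u j, c (D u) j = ((j : ℂ) + 1) * c u (j + 1) := by
  choose z hz using hw
  have hinj := smul_left_injective ℂ hw0
  let c : RatFunc ℂ →ₗ[ℂ] (ℤ → ℂ) :=
    { toFun := fun u j => z u (-(j : ℚ) - 1)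
      map_add' := fun u v => funext fun j => hinj (by
        simp only [Pi.add_apply, ← hz, map_add, LinearMap.add_apply, add_smul])
      map_smul' := fun a u => funext fun j => hinj (by
        simp only [Pi.smul_apply, ← hz, map_smul, LinearMap.smul_apply, smul_assoc,
          RingHom.id_apply]) }
  have hcz : ∀ u (j : ℤ), Y u (-(j : ℚ) - 1) w = c u j • w := fun u j => hz u _
  have hvanish : ∀ u (a : ℤ), (∀ j < a, c u j = 0) →
      ∀ i : ℕ, Y u (-(a : ℚ) - 1 + 1 + i) w = 0 := fun u a h i => by
    rw [show (-(a : ℚ) - 1 + 1 + i) = -((a - 1 - i : ℤ) : ℚ) - 1 by push_cast; ring, hcz,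
      h _ (by omega), zero_smul]
  have hcoset : ∀ a : ℤ, ∃ k : ℤ, -(a : ℚ) - 1 =
      ((0 : ℕ) : ℚ) / (orderOf (1 : RatFunc ℂ ≃ₐ[ℂ] RatFunc ℂ) : ℚ) + k :=
    fun a => ⟨-a - 1, by push_cast; simp⟩
  refine ⟨c, hcz, ⟨fun j => hinj ?_, fun u => ?_, fun u v a b hu hv => hinj ?_⟩,
    fun u j => hinj ?_⟩
  · simp only
    rw [← hcz, hY.vacuum]
    by_cases hj : j = 0
    · simp [hj]
    · rw [if_neg hj, if_neg (fun h => hj (by exact_mod_cast (by linarith : (j : ℚ) = 0)))]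
      simp
  · obtain ⟨N, hN⟩ := hY.truncation u w
    refine ⟨-⌈N⌉ - 1, fun j hj => hinj ?_⟩
    simp only
    rw [← hcz, zero_smul]
    refine hN _ ?_
    have h1 : (⌈N⌉ : ℚ) ≤ -j - 1 := by exact_mod_cast (by omega : ⌈N⌉ ≤ -j - 1)
    exact (Int.le_ceil N).trans h1
  · simp only
    have h := IsTwistedModule.mul_top hY (r := 0) (s := 0) (by simp) (by simp) (inEigenspace_one u)
      (inEigenspace_one v) (hcoset a) (hcoset b) (hvanish u a hu) (hvanish v b hv)
    rw [hcz v b, map_smul, hcz u a, smul_smul, mul_comm (c v b)] at h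
    rw [← hcz, ← h, show -((a + b : ℤ) : ℚ) - 1 = -(a : ℚ) - 1 + (-(b : ℚ) - 1) + 1 by
      push_cast; ring]
  · simp only
    rw [← hcz, mul_smul, ← hcz]
    rw [show -(j : ℚ) - 1 = ((-j - 1 : ℤ) : ℚ) by push_cast; ring, hY.derivation,
      LinearMap.smul_apply, show -((-j - 1 : ℤ) : ℂ) = (j : ℂ) + 1 by push_cast; ring,
      show -((j + 1 : ℤ) : ℚ) - 1 = ((-j - 1 : ℤ) : ℚ) - 1 by push_cast; ring]

end EigenvectorPlace

/-! ### The parity of the order of f(s) -/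

section QuadraticExtension

variable {f : ℂ[X]}

theorem root_mul_root (f : ℂ[X]) :
    AdjoinRoot.root (quadPoly f) * AdjoinRoot.root (quadPoly f) =
      algebraMap (RatFunc ℂ) (QuadExt f) (algebraMap ℂ[X] (RatFunc ℂ) f) := by
  have h := AdjoinRoot.eval₂_root (quadPoly f)
  rw [eval₂_quadPoly, sub_eq_zero, sq] at h
  exact h

theorem sigma_root (f : ℂ[X]) :
    sigma f (AdjoinRoot.root (quadPoly f)) = -AdjoinRoot.root (quadPoly f) := by
  change sigmaHom f (AdjoinRoot.root (quadPoly f)) = _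
  simp [sigmaHom]

theorem sigma_algebraMap (f : ℂ[X]) (a : RatFunc ℂ) :
    sigma f (algebraMap (RatFunc ℂ) (QuadExt f) a) = algebraMap (RatFunc ℂ) (QuadExt f) a :=
  (sigmaHom f).commutes a

theorem sigma_ne_one (hf : f ≠ 0) : sigma f ≠ 1 := fun h => by
  have hdeg : (quadPoly f).degree ≠ 0 := by
    rw [quadPoly, degree_X_pow_sub_C two_pos]
    decide
  have := AdjoinRoot.nontrivial (quadPoly f) hdeg
  have h1 := sigma_root f
  rw [h, AlgEquiv.one_apply, eq_neg_iff_add_eq_zero, ← two_smul ℂ, smul_eq_zero] at h1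
  have h2 := root_mul_root f
  rw [h1.resolve_left two_ne_zero, mul_zero, eq_comm, FaithfulSMul.algebraMap_eq_zero_iff,
    FaithfulSMul.algebraMap_eq_zero_iff] at h2
  exact hf h2

theorem orderOf_sigma (hf : f ≠ 0) : orderOf (sigma f) = 2 := by
  refine orderOf_eq_prime ?_ (sigma_ne_one hf)
  refine AlgEquiv.ext fun a => ?_
  exact DFunLike.congr_fun (sigmaHom_comp f) a

theorem inEigenspace_sigma_algebraMap (f : ℂ[X]) (a : RatFunc ℂ) :
    InEigenspace (sigma f) 0 (algebraMap (RatFunc ℂ) (QuadExt f) a) := by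
  rw [InEigenspace, sigma_algebraMap, pow_zero, one_smul]

theorem inEigenspace_sigma_root (hf : f ≠ 0) :
    InEigenspace (sigma f) 1 (AdjoinRoot.root (quadPoly f)) := by
  rw [InEigenspace, sigma_root, orderOf_sigma hf, pow_one, Nat.cast_ofNat,
    show (2 * Real.pi * Complex.I / 2 : ℂ) = Real.pi * Complex.I by ring, Complex.exp_pi_mul_I,
    neg_one_smul]

variable {M : Type*} [AddCommGroup M] [Module ℂ M] {D : Derivation ℂ (RatFunc ℂ) (RatFunc ℂ)}
  {DK : Derivation ℂ (QuadExt f) (QuadExt f)} {g : QuadExt f ≃ₐ[ℂ] QuadExt f}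
  {Y : RatFunc ℂ →ₗ[ℂ] (ℚ → Module.End ℂ M)} {Z : QuadExt f →ₗ[ℂ] (ℚ → Module.End ℂ M)}

/-- If `t ∈ K^r` with `2 r / p = e`, the order of `f(s) = t²` has the parity of `e`. -/
theorem IsTwistedStructureOver.exists_order (hf : f ≠ 0) (hZ : IsTwistedStructureOver DK g Y Z)
    {r : ℕ} (hr : r < orderOf g) (ht : InEigenspace g r (AdjoinRoot.root (quadPoly f)))
    {e : ℤ} (he : 2 * ((r : ℚ) / (orderOf g : ℚ)) = e) {w : M} (hw0 : w ≠ 0)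
    (hw : ∀ i, ∃ z : ℂ, Z (AdjoinRoot.root (quadPoly f)) i w = z • w)
    {c : RatFunc ℂ →ₗ[ℂ] (ℤ → ℂ)} (hcY : ∀ u (j : ℤ), Y u (-(j : ℚ) - 1) w = c u j • w)
    (hc : IsLaurentPlace c) :
    ∃ n : ℤ, HasOrder c (algebraMap ℂ[X] (RatFunc ℂ) f) n ∧ (Odd n ↔ Odd e) := by
  obtain ⟨hZm, hZY⟩ := hZ
  have htt := root_mul_root f
  generalize AdjoinRoot.root (quadPoly f) = t at *
  generalize hρ : (r : ℚ) / (orderOf g : ℚ) = ρ at *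
  have hcoset : ∀ k : ℤ, ∃ k' : ℤ, ρ + k = (r : ℚ) / (orderOf g : ℚ) + k' :=
    fun k => ⟨k, by rw [hρ]⟩
  have hne : ∃ k : ℤ, Z t (ρ + k) w ≠ 0 := by
    by_contra! h
    obtain ⟨n, hn⟩ := hc.exists_hasOrder (u := algebraMap ℂ[X] (RatFunc ℂ) f)
      (by rwa [Ne, FaithfulSMul.algebraMap_eq_zero_iff])
    have hvanish : ∀ (k : ℤ) (i : ℕ), Z t (ρ + k + 1 + i) w = 0 := fun k i => by
      have := h (k + 1 + i)
      push_cast at this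
      rwa [← add_assoc, ← add_assoc] at this
    -- The two indices are chosen so that the resulting mode of t² = f(s) is -n - 1, the coefficient
    -- of x^n, which is nonzero on w.
    have h1 := hZm.mul_top hr hr ht ht (hcoset (-n - 2 - e)) (hcoset 0) (hvanish _) (hvanish _)
    rw [h, map_zero, htt, hZY] at h1
    have h2 := hcY (algebraMap ℂ[X] (RatFunc ℂ) f) n
    rw [show -(n : ℚ) - 1 = ρ + ((-n - 2 - e : ℤ) : ℚ) + (ρ + ((0 : ℤ) : ℚ)) + 1 by
      push_cast; linear_combination -he, h1] at h2
    exact smul_ne_zero hn.2 hw0 h2.symm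
  obtain ⟨N, hN⟩ := hZm.truncation t w
  obtain ⟨k, hk, hmax⟩ := Int.exists_greatest_of_bdd (P := fun k : ℤ => Z t (ρ + k) w ≠ 0)
    ⟨⌈N - ρ⌉, fun k hk => by
      by_contra! h
      refine hk (hN _ ?_)
      have h1 : ((⌈N - ρ⌉ : ℤ) : ℚ) < k := by exact_mod_cast h
      linarith [Int.le_ceil (N - ρ)]⟩ hne
  have hvanish : ∀ i : ℕ, Z t (ρ + k + 1 + i) w = 0 := fun i => by
    by_contra h
    have := hmax (k + 1 + i) (by push_cast; rwa [← add_assoc, ← add_assoc])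
    omega
  -- The top mode of t is ρ + k, so that of t² is 2(ρ + k) + 1 = e + 2k + 1; mode i is the
  -- coefficient of x^(-i-1).
  refine ⟨-e - 2 * k - 2, ⟨fun j hj => ?_, fun h => ?_⟩, ?_⟩
  · obtain ⟨d, hd⟩ := Int.le.dest (Int.add_one_le_of_lt hj)
    have h1 := hZm.mul_above_top hr hr ht ht (hcoset k) (hcoset k) hvanish hvanish d
    have hd' : (j : ℚ) + 1 + d = -e - 2 * k - 2 := by exact_mod_cast hd
    rw [htt, hZY, show ρ + k + (ρ + k) + 1 + ((d : ℚ) + 1) = -(j : ℚ) - 1 by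
      linear_combination he + hd', hcY] at h1
    exact (smul_eq_zero.1 h1).resolve_right hw0
  · have h1 := hZm.mul_top hr hr ht ht (hcoset k) (hcoset k) hvanish hvanish
    rw [htt, hZY, show ρ + k + (ρ + k) + 1 = -((-e - 2 * k - 2 : ℤ) : ℚ) - 1 by
      push_cast; linear_combination he, hcY, h, zero_smul] at h1
    obtain ⟨z, hz⟩ := hw (ρ + k)
    rw [hz, map_smul, hz, smul_smul, eq_comm, smul_eq_zero, mul_self_eq_zero] at h1
    rw [hz] at hk
    exact hk (by rw [h1.resolve_right hw0, zero_smul])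
  · simp only [Int.odd_iff]
    omega

/-- The parity of the order of `f(s)` at a common eigenvector distinguishes `σ` from `1`. -/
theorem IsTwistedStructureOver.exists_place [FiniteDimensional ℂ M] [Nontrivial M] (hf : f ≠ 0)
    (hY : IsVertexModule D Y) (hg : g = 1 ∨ g = sigma f) (hZ : IsTwistedStructureOver DK g Y Z) :
    ∃ (w : M) (c : RatFunc ℂ →ₗ[ℂ] (ℤ → ℂ)) (n : ℤ), w ≠ 0 ∧
      (∀ u (j : ℤ), Y u (-(j : ℚ) - 1) w = c u j • w) ∧ IsLaurentPlace c ∧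
      (∀ u j, c (D u) j = ((j : ℂ) + 1) * c u (j + 1)) ∧
      HasOrder c (algebraMap ℂ[X] (RatFunc ℂ) f) n ∧ (g = sigma f ↔ Odd n) := by
  obtain ⟨r, e, hr, h0, ht, he, hodd⟩ : ∃ (r : ℕ) (e : ℤ), r < orderOf g ∧
      (∀ a, InEigenspace g 0 (algebraMap (RatFunc ℂ) (QuadExt f) a)) ∧
      InEigenspace g r (AdjoinRoot.root (quadPoly f)) ∧
      2 * ((r : ℚ) / (orderOf g : ℚ)) = e ∧ (g = sigma f ↔ Odd e) := by
    rcases hg with rfl | rfl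
    · exact ⟨0, 0, by simp, fun a => inEigenspace_one _, inEigenspace_one _, by simp,
        by simp [(sigma_ne_one hf).symm]⟩
    · exact ⟨1, 1, by simp [orderOf_sigma hf], inEigenspace_sigma_algebraMap f,
        inEigenspace_sigma_root hf, by simp [orderOf_sigma hf], by simp⟩
  have hpos : 0 < orderOf g := hr.pos
  set t := AdjoinRoot.root (quadPoly f)
  have hYt : ∀ u i j, Commute (Y u i) (Z t j) := fun u i j => by
    rw [← hZ.2]
    exact hZ.1.commute hpos hr (h0 u) ht i j
  obtain ⟨w, hw0, hw⟩ := exists_common_eigenvector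
    ({T | ∃ u i, Y u i = T} ∪ {T | ∃ i, Z t i = T}) (by
      rintro _ (⟨u, i, rfl⟩ | ⟨i, rfl⟩) _ (⟨v, j, rfl⟩ | ⟨j, rfl⟩)
      · exact hY.commute u v i j
      · exact hYt u i j
      · exact (hYt v j i).symm
      · exact hZ.1.commute hr hr ht ht i j)
  obtain ⟨c, hcY, hc, hcD⟩ := hY.exists_isLaurentPlace hw0
    (fun u i => hw _ (Or.inl ⟨u, i, rfl⟩))
  obtain ⟨n, hn, hne⟩ := hZ.exists_order hf hr ht he hw0 (fun i => hw _ (Or.inr ⟨i, rfl⟩)) hcY hc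
  exact ⟨w, c, n, hw0, hcY, hc, hcD, hn, hodd.trans hne.symm⟩

end QuadraticExtension

end DiffVertex

end

/-! ### The three cases -/

theorem mainTheorem3
    (D : Derivation ℂ (RatFunc ℂ) (RatFunc ℂ)) (hD : D ≠ 0)
    (f : Polynomial ℂ) (hf : Squarefree f) (hdeg : 3 ≤ f.natDegree)
    (DK : Derivation ℂ (DiffVertex.QuadExt f) (DiffVertex.QuadExt f))
    (hDK : ∀ a : RatFunc ℂ, DK (algebraMap (RatFunc ℂ) (DiffVertex.QuadExt f) a) =
      algebraMap (RatFunc ℂ) (DiffVertex.QuadExt f) (D a))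
    {M : Type*} [AddCommGroup M] [Module ℂ M] [FiniteDimensional ℂ M]
    (Y : RatFunc ℂ →ₗ[ℂ] (ℚ → Module.End ℂ M))
    (hY : DiffVertex.IsVertexModule D Y) (hYind : DiffVertex.IsIndecomposable Y)
    (g : DiffVertex.QuadExt f ≃ₐ[ℂ] DiffVertex.QuadExt f)
    (hg : g = 1 ∨ g = DiffVertex.sigma f)
    (Z : DiffVertex.QuadExt f →ₗ[ℂ] (ℚ → Module.End ℂ M))
    (hZ : DiffVertex.IsTwistedStructureOver DK g Y Z) :
    (DiffVertex.HasLowestDegree (DiffVertex.semisimpleCoeff (Y RatFunc.X)) 1 →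
      (g = DiffVertex.sigma f ↔ f.coeff 0 = 0)) ∧
    (DiffVertex.HasLowestDegree (DiffVertex.semisimpleCoeff (Y RatFunc.X)) 0 →
      (g = DiffVertex.sigma f ↔
        Polynomial.aeval (DiffVertex.semisimpleCoeff (Y RatFunc.X) 0) f = 0)) ∧
    (DiffVertex.HasLowestDegree (DiffVertex.semisimpleCoeff (Y RatFunc.X)) (-1) →
      (g = DiffVertex.sigma f ↔ Odd f.natDegree)) := by
  have hf0 : f ≠ 0 := hf.ne_zero
  have hMnt : Nontrivial M := hYind.1
  obtain ⟨w, c, n, hw0, hcY, hc, hcD, hn, hodd⟩ := hZ.exists_place hf0 hY hg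
  have hss : ∀ j, DiffVertex.semisimpleCoeff (Y RatFunc.X) j =
      c RatFunc.X j • (1 : Module.End ℂ M) := fun j =>
    DiffVertex.semisimplePart_eq_smul_one
      (hYind.isNilpotent_sub (hY.commute RatFunc.X · _ ·) hw0 (hcY RatFunc.X j))
  have horder : ∀ L, DiffVertex.HasLowestDegree (DiffVertex.semisimpleCoeff (Y RatFunc.X)) L →
      DiffVertex.HasOrder c RatFunc.X L := fun L hL => by
    refine ⟨fun j hj => ?_, fun h => hL.1 (by rw [hss, h, zero_smul])⟩
    by_contra h
    have hmem : DiffVertex.semisimpleCoeff (Y RatFunc.X) j ≠ 0 := by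
      rw [hss]
      exact smul_ne_zero h one_ne_zero
    exact absurd (hL.2 hmem) (not_le.2 hj)
  rw [hodd]
  refine ⟨fun hL => ?_, fun hL => ?_, fun hL => ?_⟩
  · have hs := (horder 1 hL).1
    rw [hc.odd_order_iff_eval_eq_zero (fun j hj => hs j (by omega)) hcD hf hn,
      hs 0 one_pos, Polynomial.coeff_zero_eq_eval_zero]
  · rw [hc.odd_order_iff_eval_eq_zero (horder 0 hL).1 hcD hf hn, hss,
      ← Algebra.algebraMap_eq_smul_one, Polynomial.aeval_algebraMap_apply,
      FaithfulSMul.algebraMap_eq_zero_iff, Polynomial.coe_aeval_eq_eval]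
  · rw [hn.unique (hc.hasOrder_neg_natDegree (horder (-1) hL) hf0), odd_neg, Int.odd_coe_nat]
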